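/- \textbf{Theorem.} Let $\lambda$ be the uniform probability measure on $2^\omega$, and for a string $\sigma\in 2^{<\omega}$ (resp. a set $S$ of strings) let $\llbracket\sigma\rrbracket$ be the set of $X\in 2^\omega$ extending $\sigma$ (resp. $\llbracket S\rrbracket=\bigcup_{\sigma\in S}\llbracket\sigma\rrbracket$). A \emph{Turing functional} $\Phi$ is a computably enumerable set of pairs of strings such that, whenever $(\sigma,\tau),(\sigma',\tau')\in\Phi$ and $\sigma$ is a prefix of $\sigma'$, one of $\tau,\tau'$ is a prefix of the other. For $X\in 2^\omega$ let $\Phi^X$ be the (finite or infinite) supremum, in the prefix order, of all $\tau$ with $(\sigma,\tau)\in\Phi$ for some prefix $\sigma$ of $X$; let $\operatorname{dom}(\Phi)$ be the set of $X$ for which $\Phi^X$ is infinite, and write $\Phi(X)=\Phi^X$ for such $X$. Call $\Phi$ \emph{almost total} if $\lambda(\operatorname{dom}(\Phi))=1$; in that case let $\lambda_\Phi$ be the unique Borel measure on $2^\omega$ with $\lambda_\Phi(\llbracket\tau\rrbracket)=\lambda(\llbracket\Phi^{-1}(\tau)\rrbracket)$ for every string $\tau$, where $\Phi^{-1}(\tau)$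 is the set of $\sigma$ such that $(\sigma,\tau')\in\Phi$ for some $\tau'$ extending $\tau$ (equivalently, $\lambda_\Phi$ is the distribution of $\Phi(X)$ when $X$ is distributed according to $\lambda$). For a Borel probability measure $\mu$ on $2^\omega$, a sequence $X\in 2^\omega$ is \emph{$\mu$-weakly 2-random} if $X\notin\bigcap_i\llbracket S_i\rrbracket$ for every uniformly computably enumerable sequence $(S_i)_{i\in\omega}$ of sets of strings with $\lim_{i\to\infty}\mu(\llbracket S_i\rrbracket)=0$; \emph{weakly 2-random} means $\lambda$-weakly 2-random. Let $\Phi$ be an almost total Turing functional. If $Y\in 2^\omega$ is $\lambda_\Phi$-weakly 2-random, then there is a weakly 2-random $X\in\operatorname{dom}(\Phi)$ such that $\Phi(X)=Y$. -/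

import Mathlib

open MeasureTheory Filter Topology

/-- Cantor space `2^ω`, with the product topology and the product (Borel) σ-algebra. -/
abbrev Cantor : Type := ℕ → Bool

namespace Cantor

/-- The string formed by the first `n` bits of `X`. -/
def restrict (X : Cantor) (n : ℕ) : List Bool := (List.range n).map X

/-- The set of infinite sequences having `σ` as an initial segment. -/
def cylinder (σ : List Bool) : Set Cantor := {X | X.restrict σ.length = σ}

/-- The open set generated by a set of strings. -/
def cylinders (S : Set (List Bool)) : Set Cantor := ⋃ σ ∈ S, cylinder σ

/-- The uniform measure `λ`: the bits are independent and unbiased. -/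
noncomputable def uniform : Measure Cantor :=
  Measure.infinitePi fun _ : ℕ => (PMF.uniformOfFintype Bool).toMeasure

instance : IsProbabilityMeasure uniform := by
  unfold uniform; infer_instance

/-- A sequence of sets of strings is uniformly computably enumerable. -/
def UniformlyCE (S : ℕ → Set (List Bool)) : Prop :=
  REPred fun p : ℕ × List Bool => p.2 ∈ S p.1

/-- A sequence of subsets of Cantor space is uniformly effectively open (uniformly `Σ⁰₁`). -/
def UniformlyEffectivelyOpen (U : ℕ → Set Cantor) : Prop :=
  ∃ S : ℕ → Set (List Bool), UniformlyCE S ∧ ∀ i, U i = cylinders (S i)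

/-- Generalized `μ`-Martin-Löf tests. -/
structure IsGeneralizedMLTest (μ : Measure Cantor) (U : ℕ → Set Cantor) : Prop where
  effectivelyOpen : UniformlyEffectivelyOpen U
  tendsto_zero : Tendsto (fun i => μ (U i)) atTop (𝓝 0)

/-- `X` is `μ`-weakly 2-random if it passes every generalized `μ`-Martin-Löf test. -/
def WeaklyTwoRandom (μ : Measure Cantor) (X : Cantor) : Prop :=
  ∀ U : ℕ → Set Cantor, IsGeneralizedMLTest μ U → X ∉ ⋂ i, U i

theorem mem_cylinder_iff {σ : List Bool} {X : Cantor} :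
    X ∈ cylinder σ ↔ ∀ (i : ℕ) (h : i < σ.length), X i = σ[i] := by
  simp only [cylinder, restrict, Set.mem_ofPred_eq]
  constructor
  · intro h i hi
    have := congrArg (fun l => l[i]?) h
    simpa [hi] using this
  · intro h
    apply List.ext_getElem
    · simp
    · intro i h1 h2
      simpa using h i h2

theorem measurableSet_cylinder (σ : List Bool) : MeasurableSet (cylinder σ) := by
  have : cylinder σ = ⋂ (i : ℕ) (h : i < σ.length), {X : Cantor | X i = σ[i]} := by
    ext X; simp [mem_cylinder_iff]
  rw [this]
  refine MeasurableSet.iInter fun i => MeasurableSet.iInter fun h => ?_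
  exact measurable_pi_apply i (measurableSet_singleton _)

theorem measurableSet_cylinders (S : Set (List Bool)) : MeasurableSet (cylinders S) :=
  MeasurableSet.biUnion S.to_countable fun σ _ => measurableSet_cylinder σ

theorem uniform_cylinder (σ : List Bool) : uniform (cylinder σ) = (2⁻¹ : ENNReal) ^ σ.length := by
  have : cylinder σ = Set.pi (Finset.range σ.length : Finset ℕ)
      (fun i => ({σ.getD i false} : Set Bool)) := by
    ext X
    simp only [mem_cylinder_iff, Set.mem_pi, Finset.coe_range, Set.mem_Iio,
      Set.mem_singleton_iff]
    refine forall_congr' fun i => forall_congr' fun h => ?_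
    simp [h]
  rw [this, uniform, Measure.infinitePi_pi _ (fun i _ => measurableSet_singleton _)]
  simp

end Cantor

section

open Cantor

/-- A Turing functional, as a c.e. set of pairs of strings `(σ, τ)` that is consistent: comparable
inputs have comparable outputs. -/
structure TuringFunctional where
  pairs : Set (List Bool × List Bool)
  ce : REPred fun p : List Bool × List Bool => p ∈ pairs
  consistent : ∀ σ τ σ₁ τ₁ : List Bool, (σ, τ) ∈ pairs → (σ₁, τ₁) ∈ pairs → σ <+: σ₁ →
    τ <+: τ₁ ∨ τ₁ <+: τ

namespace TuringFunctional

/-- The strings that `Φ` outputs on initial segments of `X`. They are pairwise comparable, and their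
supremum in the prefix order is the finite or infinite sequence `Φ^X`. -/
def outputs (Φ : TuringFunctional) (X : Cantor) : Set (List Bool) :=
  {τ | ∃ σ, (σ, τ) ∈ Φ.pairs ∧ X ∈ cylinder σ}

/-- `Φ^X` is infinite and equals `Y`. -/
def Maps (Φ : TuringFunctional) (X Y : Cantor) : Prop :=
  (∀ τ ∈ Φ.outputs X, Y ∈ cylinder τ) ∧ ∀ n : ℕ, ∃ τ ∈ Φ.outputs X, n ≤ τ.length

/-- The set of `X` for which `Φ^X` is infinite. -/
def dom (Φ : TuringFunctional) : Set Cantor := {X | ∃ Y, Φ.Maps X Y}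

open Classical in
/-- The value `Φ(X)`, for `X` in the domain of `Φ`; a constant sequence elsewhere. -/
noncomputable def apply (Φ : TuringFunctional) (X : Cantor) : Cantor :=
  if h : ∃ Y, Φ.Maps X Y then h.choose else fun _ => false

/-- `Φ` is almost total if its domain has uniform measure one. -/
def AlmostTotal (Φ : TuringFunctional) : Prop := uniform Φ.dom = 1

/-- The set of strings `Φ⁻¹(τ)`. -/
def preimage (Φ : TuringFunctional) (τ : List Bool) : Set (List Bool) :=
  {σ | ∃ τ₁, τ <+: τ₁ ∧ (σ, τ₁) ∈ Φ.pairs}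

/-- The measure `λ_Φ` induced by an almost total `Φ`: the distribution of `Φ(X)` for uniform `X`.
It is the unique measure with `λ_Φ ⟦τ⟧ = λ ⟦Φ⁻¹(τ)⟧` for all strings `τ`: see
`inducedMeasure_cylinder` and `eq_inducedMeasure`. -/
noncomputable def inducedMeasure (Φ : TuringFunctional) : Measure Cantor :=
  uniform.map Φ.apply

theorem Maps.unique {Φ : TuringFunctional} {X Y Z : Cantor} (hY : Φ.Maps X Y) (hZ : Φ.Maps X Z) :
    Y = Z := by
  funext k
  obtain ⟨τ, hτ, hk⟩ := hY.2 (k + 1)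
  rw [mem_cylinder_iff.1 (hY.1 τ hτ) k hk, mem_cylinder_iff.1 (hZ.1 τ hτ) k hk]

theorem maps_apply {Φ : TuringFunctional} {X : Cantor} (h : X ∈ Φ.dom) : Φ.Maps X (Φ.apply X) := by
  have h1 : ∃ Y, Φ.Maps X Y := h
  unfold apply
  rw [dif_pos h1]
  exact h1.choose_spec

theorem maps_iff {Φ : TuringFunctional} {X Y : Cantor} :
    Φ.Maps X Y ↔ X ∈ Φ.dom ∧ Φ.apply X = Y :=
  ⟨fun h => ⟨⟨Y, h⟩, (maps_apply ⟨Y, h⟩).unique h⟩, fun h => h.2 ▸ maps_apply h.1⟩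

theorem cylinder_comparable {σ τ : List Bool} {X : Cantor} (h1 : X ∈ cylinder σ)
    (h2 : X ∈ cylinder τ) (h : σ.length ≤ τ.length) : σ <+: τ := by
  rw [List.prefix_iff_eq_take]
  apply List.ext_getElem
  · simp [h]
  · intro i hi hj
    rw [List.getElem_take, ← mem_cylinder_iff.1 h1 i hi,
      ← mem_cylinder_iff.1 h2 i (hi.trans_le h)]

theorem cylinder_anti {σ τ : List Bool} (h : σ <+: τ) : cylinder τ ⊆ cylinder σ := by
  intro X hX
  rw [mem_cylinder_iff] at hX ⊢
  intro i hi
  rw [hX i (hi.trans_le h.length_le), h.getElem]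

theorem outputs_comparable {Φ : TuringFunctional} {X : Cantor} {τ τ₁ : List Bool}
    (h : τ ∈ Φ.outputs X) (h1 : τ₁ ∈ Φ.outputs X) : τ <+: τ₁ ∨ τ₁ <+: τ := by
  obtain ⟨σ, hσ, hX⟩ := h
  obtain ⟨σ₁, hσ₁, hX₁⟩ := h1
  rcases le_total σ.length σ₁.length with hl | hl
  · exact Φ.consistent _ _ _ _ hσ hσ₁ (cylinder_comparable hX hX₁ hl)
  · exact (Φ.consistent _ _ _ _ hσ₁ hσ (cylinder_comparable hX₁ hX hl)).symm

theorem mem_dom_iff {Φ : TuringFunctional} {X : Cantor} :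
    X ∈ Φ.dom ↔ ∀ n : ℕ, ∃ τ ∈ Φ.outputs X, n ≤ τ.length := by
  refine ⟨fun ⟨Y, hY⟩ => hY.2, fun h => ?_⟩
  choose f hf hl using h
  refine ⟨fun k => (f (k + 1)).getD k false, ?_, fun n => ⟨f n, hf n, hl n⟩⟩
  intro τ hτ
  rw [mem_cylinder_iff]
  intro i hi
  have hk : i < (f (i + 1)).length := hl (i + 1)
  rw [List.getD_eq_getElem _ _ hk]
  rcases outputs_comparable hτ (hf (i + 1)) with hp | hp
  · exact (hp.getElem hi).symm
  · exact hp.getElem hk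

theorem measurableSet_dom (Φ : TuringFunctional) : MeasurableSet Φ.dom := by
  have : Φ.dom = ⋂ n : ℕ, ⋃ p ∈ {p | p ∈ Φ.pairs ∧ n ≤ p.2.length}, cylinder p.1 := by
    ext X
    simp only [mem_dom_iff, outputs, Set.mem_ofPred_eq, Set.mem_iInter, Set.mem_iUnion]
    refine forall_congr' fun n => ⟨?_, ?_⟩
    · rintro ⟨τ, ⟨σ, h, hX⟩, hn⟩
      exact ⟨(σ, τ), ⟨h, hn⟩, hX⟩
    · rintro ⟨⟨σ, τ⟩, ⟨h, hn⟩, hX⟩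
      exact ⟨τ, ⟨σ, h, hX⟩, hn⟩
  rw [this]
  exact MeasurableSet.iInter fun n =>
    MeasurableSet.biUnion (Set.to_countable _) fun p _ => measurableSet_cylinder p.1

theorem apply_mem_cylinder {Φ : TuringFunctional} {X : Cantor} (h : X ∈ Φ.dom) (τ : List Bool) :
    Φ.apply X ∈ cylinder τ ↔ X ∈ cylinders (Φ.preimage τ) := by
  have hm := maps_apply h
  simp only [cylinders, preimage, Set.mem_iUnion, Set.mem_ofPred_eq]
  constructor
  · intro hY
    obtain ⟨τ₁, ⟨σ, hσ, hX⟩, hl⟩ := hm.2 τ.length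
    exact ⟨σ, ⟨τ₁, cylinder_comparable hY (hm.1 _ ⟨σ, hσ, hX⟩) hl, hσ⟩, hX⟩
  · rintro ⟨σ, ⟨τ₁, hp, hσ⟩, hX⟩
    exact cylinder_anti hp (hm.1 _ ⟨σ, hσ, hX⟩)

theorem measurable_apply (Φ : TuringFunctional) : Measurable Φ.apply := by
  refine measurable_pi_lambda _ fun k => measurable_to_bool ?_
  have : (fun X => Φ.apply X k) ⁻¹' {true} = Φ.dom ∩
      ⋃ τ ∈ {τ : List Bool | τ[k]? = some true}, cylinders (Φ.preimage τ) := by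
    ext X
    simp only [Set.mem_preimage, Set.mem_singleton_iff, Set.mem_inter_iff, Set.mem_iUnion,
      Set.mem_ofPred_eq]
    constructor
    · intro h
      have hX : X ∈ Φ.dom := by
        by_contra hX
        have h1 : ¬ ∃ Y, Φ.Maps X Y := hX
        simp [apply, dif_neg h1] at h
      refine ⟨hX, (Φ.apply X).restrict (k + 1), ?_, (apply_mem_cylinder hX _).1 ?_⟩
      · simp [restrict, h]
      · simp [Cantor.cylinder, restrict]
    · rintro ⟨hX, τ, hτ, h⟩
      obtain ⟨hk, ht⟩ := List.getElem?_eq_some_iff.1 hτ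
      rw [mem_cylinder_iff.1 ((apply_mem_cylinder hX τ).2 h) k hk, ht]
  rw [this]
  exact Φ.measurableSet_dom.inter
    (MeasurableSet.biUnion (Set.to_countable _) fun τ _ => measurableSet_cylinders _)

theorem inducedMeasure_cylinder {Φ : TuringFunctional} (hΦ : Φ.AlmostTotal) (τ : List Bool) :
    Φ.inducedMeasure (cylinder τ) = uniform (cylinders (Φ.preimage τ)) := by
  rw [inducedMeasure, Measure.map_apply Φ.measurable_apply (measurableSet_cylinder τ)]
  have hae : ∀ᵐ X ∂uniform, X ∈ Φ.dom :=
    (mem_ae_iff_prob_eq_one Φ.measurableSet_dom).2 hΦ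
  refine measure_congr ?_
  filter_upwards [hae] with X hX
  exact propext (apply_mem_cylinder hX τ)

theorem eq_inducedMeasure {Φ : TuringFunctional} (hΦ : Φ.AlmostTotal) (μ : Measure Cantor)
    (hμ : ∀ τ, μ (cylinder τ) = uniform (cylinders (Φ.preimage τ))) : μ = Φ.inducedMeasure := by
  have huniv : cylinder [] = Set.univ := by ext X; simp [mem_cylinder_iff]
  have heq : ∀ τ, μ (cylinder τ) = Φ.inducedMeasure (cylinder τ) := fun τ => by
    rw [hμ, inducedMeasure_cylinder hΦ]
  have hprob : IsProbabilityMeasure Φ.inducedMeasure :=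
    Measure.isProbabilityMeasure_map Φ.measurable_apply.aemeasurable
  have hfin : IsFiniteMeasure μ := ⟨by rw [← huniv, heq]; exact measure_lt_top _ _⟩
  refine ext_of_generate_finite (Set.range cylinder) ?_ ?_ ?_ ?_
  · apply le_antisymm
    · refine iSup_le fun k => ?_
      rw [← measurable_iff_comap_le]
      refine @measurable_to_bool _ (MeasurableSpace.generateFrom (Set.range cylinder)) _ ?_
      have : (fun X : Cantor => X k) ⁻¹' {true} =
          cylinders {τ | τ[k]? = some true} := by
        ext X
        simp only [Set.mem_preimage, Set.mem_singleton_iff, cylinders, Set.mem_iUnion,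
          Set.mem_ofPred_eq]
        constructor
        · intro h
          exact ⟨X.restrict (k + 1), by simp [restrict, h], by simp [Cantor.cylinder, restrict]⟩
        · rintro ⟨τ, hτ, h⟩
          obtain ⟨hk, ht⟩ := List.getElem?_eq_some_iff.1 hτ
          rw [mem_cylinder_iff.1 h k hk, ht]
      rw [this]
      exact MeasurableSet.biUnion (Set.to_countable _) fun τ _ =>
        MeasurableSpace.measurableSet_generateFrom ⟨τ, rfl⟩
    · refine MeasurableSpace.generateFrom_le ?_
      rintro _ ⟨τ, rfl⟩
      exact measurableSet_cylinder τ
  · rintro _ ⟨σ, rfl⟩ _ ⟨τ, rfl⟩ ⟨X, h1, h2⟩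
    rcases le_total σ.length τ.length with hl | hl
    · exact ⟨τ, (Set.inter_eq_right.2 (cylinder_anti (cylinder_comparable h1 h2 hl))).symm⟩
    · exact ⟨σ, (Set.inter_eq_left.2 (cylinder_anti (cylinder_comparable h2 h1 hl))).symm⟩
  · rintro _ ⟨τ, rfl⟩
    exact heq τ
  · rw [← huniv]
    exact heq []

end TuringFunctional

end

/-! ### C.e. predicates, their stages and closure properties; binary strings -/

section Enumerability

variable {α β : Type*} [Primcodable α] [Primcodable β]

/-! Given a uniform test `U` and `k`, let `T i` be the set of `τ` such that `U i` has conditional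
measure above `2^{-k}` given that `Φ(X)` extends `τ`. Almost totality makes `λ_Φ⟦τ⟧` approximable
from above, so `T i` is c.e. uniformly in `i` (`rePred_inducedMeasure_lt`), and the maximal
inequality `measure_cylinders_le` gives `λ_Φ⟦T i⟧ ≤ 2^k λ(U i) → 0`. Hence `Y` avoids some `⟦T i⟧`:
a single `i` keeps the conditional measure at most `2^{-k}` along all initial segments of `Y`
(`exists_conditional_le`).

There are only countably many tests, so a component can be chosen from each with these bounds
summing to less than 1. The union `O` of the chosen components is open and does not cover the
preimage of any cylinder around `Y`. By compactness some `X` outside `O` has all its outputs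
compatible with `Y`. This `X` passes every test, so it is weakly 2-random and therefore lies in the
domain (`mem_dom_of_weaklyTwoRandom`), where compatibility forces `Φ(X) = Y`. -/

theorem REPred.exists_code {p : α → Prop} (hp : REPred p) :
    ∃ c : Nat.Partrec.Code, ∀ a, p a ↔ (c.eval (Encodable.encode a)).Dom := by
  obtain ⟨c, hc⟩ := Nat.Partrec.Code.exists_code.1 hp
  refine ⟨c, fun a => ?_⟩
  rw [hc]
  simp [Part.assert, Part.some]

/-- A c.e. predicate is the increasing union of primitive recursive stages. -/
theorem REPred.exists_stages {p : α → Prop} (hp : REPred p) :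
    ∃ R : α → ℕ → Prop, PrimrecRel R ∧ (∀ a s t, s ≤ t → R a s → R a t) ∧
      ∀ a, p a ↔ ∃ s, R a s := by
  obtain ⟨c, hc⟩ := hp.exists_code
  refine ⟨fun a s => (c.evaln s (Encodable.encode a)).isSome = true, ?_, ?_, fun a => ?_⟩
  · have h : Primrec fun x : α × ℕ => (c.evaln x.2 (Encodable.encode x.1)).isSome :=
      Primrec.option_isSome.comp <| Nat.Partrec.Code.primrec_evaln.comp <|
        (Primrec.snd.pair (Primrec.const c)).pair (Primrec.encode.comp Primrec.fst)
    exact Primrec.eq.comp h (Primrec.const true)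
  · intro a s t hst h
    obtain ⟨x, hx⟩ := Option.isSome_iff_exists.1 h
    exact Option.isSome_iff_exists.2 ⟨x, Nat.Partrec.Code.evaln_mono hst hx⟩
  · simp only [hc, Part.dom_iff_mem, Nat.Partrec.Code.evaln_complete, Option.isSome_iff_exists,
      Option.mem_def]
    exact exists_comm

theorem PrimrecRel.rePred_exists {R : α → ℕ → Prop} (hR : PrimrecRel R) :
    REPred fun a => ∃ s, R a s := by
  classical
  have h : Partrec fun a => Nat.rfind ((fun s => decide (R a s) : ℕ → Bool) : ℕ →. Bool) :=
    Partrec.rfind (Primrec.to_comp hR.decide).partrec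
  refine (Partrec.dom_re h).of_eq fun a => Nat.rfind_dom.trans ?_
  simp only [PFun.coe_val, Part.mem_some_iff, Part.some_dom]
  simp

theorem REPred.and {p q : α → Prop} (hp : REPred p) (hq : REPred q) :
    REPred fun a => p a ∧ q a := by
  obtain ⟨R, hR, hRm, hRp⟩ := hp.exists_stages
  obtain ⟨Q, hQ, hQm, hQq⟩ := hq.exists_stages
  have h : PrimrecRel fun a s => R a s ∧ Q a s := PrimrecPred.and hR hQ
  refine h.rePred_exists.of_eq fun a => ?_
  rw [hRp, hQq]
  constructor
  · rintro ⟨s, h1, h2⟩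
    exact ⟨⟨s, h1⟩, s, h2⟩
  · rintro ⟨⟨s, h1⟩, t, h2⟩
    exact ⟨max s t, hRm _ _ _ (le_max_left _ _) h1, hQm _ _ _ (le_max_right _ _) h2⟩

theorem REPred.exists {q : α × β → Prop} (hq : REPred q) : REPred fun a => ∃ b, q (a, b) := by
  classical
  obtain ⟨R, hR, hRm, hRq⟩ := hq.exists_stages
  -- The number `n` codes a candidate witness together with a stage confirming it.
  have h : PrimrecRel fun (a : α) (n : ℕ) =>
      ((Encodable.decode (α := β) n.unpair.1).casesOn false
        fun b => decide (R (a, b) n.unpair.2) : Bool) = true := by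
    refine Primrec.eq.comp ?_ (Primrec.const true)
    refine Primrec.option_casesOn
      (Primrec.decode.comp (Primrec.fst.comp (Primrec.unpair.comp Primrec.snd)))
      (Primrec.const false) ?_
    exact (hR.decide.comp ((Primrec.fst.comp Primrec.fst).pair Primrec.snd)
      (Primrec.snd.comp (Primrec.unpair.comp (Primrec.snd.comp Primrec.fst))))
  refine h.rePred_exists.of_eq fun a => ?_
  simp only [hRq]
  constructor
  · rintro ⟨n, hn⟩
    cases hb : Encodable.decode (α := β) n.unpair.1 with
    | none => simp [hb] at hn
    | some b => exact ⟨b, n.unpair.2, by simpa [hb] using hn⟩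
  · rintro ⟨b, s, hs⟩
    exact ⟨Nat.pair (Encodable.encode b) s, by simpa using hs⟩

theorem REPred.comp {p : β → Prop} (hp : REPred p) {f : α → β} (hf : Computable f) :
    REPred fun a => p (f a) :=
  Partrec.comp (f := fun b => Part.assert (p b) fun _ => Part.some ()) hp hf

theorem PrimrecPred.rePred {p : α → Prop} (hp : PrimrecPred p) : REPred p :=
  hp.computablePred.to_re

theorem primrecRel_prefix [DecidableEq α] : PrimrecRel fun σ τ : List α => σ <+: τ := by
  refine PrimrecRel.of_eq (r := fun σ τ : List α => σ = τ.take σ.length) ?_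
    fun σ τ => List.prefix_iff_eq_take.symm
  exact Primrec.eq.comp Primrec.fst
    (Primrec.list_take.comp (Primrec.list_length.comp Primrec.fst) Primrec.snd)

/-- The binary strings of length `s`. -/
def binaryStrings : ℕ → List (List Bool)
  | 0 => [[]]
  | s + 1 => (binaryStrings s).map (List.cons false) ++ (binaryStrings s).map (List.cons true)

theorem mem_binaryStrings {s : ℕ} {σ : List Bool} : σ ∈ binaryStrings s ↔ σ.length = s := by
  induction s generalizing σ with
  | zero => simp [binaryStrings]
  | succ s ih =>
    cases σ with
    | nil => simp [binaryStrings]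
    | cons b σ => cases b <;> simp [binaryStrings, ih]

theorem nodup_binaryStrings (s : ℕ) : (binaryStrings s).Nodup := by
  induction s with
  | zero => simp [binaryStrings]
  | succ s ih =>
    refine List.Nodup.append (ih.map List.cons_injective) (ih.map List.cons_injective) ?_
    intro σ h1 h2
    obtain ⟨_, _, rfl⟩ := List.mem_map.1 h1
    simp at h2

theorem primrec_binaryStrings : Primrec binaryStrings := by
  have h : Primrec₂ fun (_ : ℕ) (l : List (List Bool)) =>
      l.map (List.cons false) ++ l.map (List.cons true) :=
    Primrec.list_append.comp
      (Primrec.list_map Primrec.snd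
        (Primrec.list_cons.comp (Primrec.const false) Primrec.snd))
      (Primrec.list_map Primrec.snd
        (Primrec.list_cons.comp (Primrec.const true) Primrec.snd))
  refine (Primrec.nat_rec₁ [[]] h).of_eq fun s => ?_
  induction s with
  | zero => rfl
  | succ s ih => simp only [binaryStrings, ← ih]

end Enumerability

/-! ### Countability of tests; measures of finite unions of cylinders -/

namespace Cantor

theorem countable_uniformlyCE : {S : ℕ → Set (List Bool) | UniformlyCE S}.Countable := by
  refine (Set.countable_range fun (c : Nat.Partrec.Code) (i : ℕ) =>
    {σ : List Bool | (c.eval (Encodable.encode (i, σ))).Dom}).mono fun S hS => ?_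
  obtain ⟨c, hc⟩ := REPred.exists_code hS
  refine ⟨c, ?_⟩
  funext i
  ext σ
  exact (hc (i, σ)).symm

theorem countable_isGeneralizedMLTest (μ : Measure Cantor) :
    {U : ℕ → Set Cantor | IsGeneralizedMLTest μ U}.Countable := by
  refine (countable_uniformlyCE.image fun S i => cylinders (S i)).mono fun U hU => ?_
  obtain ⟨S, hS, hUS⟩ := hU.effectivelyOpen
  exact ⟨S, hS, (funext hUS).symm⟩

theorem length_restrict (X : Cantor) (n : ℕ) : (X.restrict n).length = n := by simp [restrict]

theorem mem_cylinder_restrict (X : Cantor) (n : ℕ) : X ∈ cylinder (X.restrict n) := by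
  simp [cylinder, restrict]

theorem take_restrict (X : Cantor) {m n : ℕ} (h : m ≤ n) :
    (X.restrict n).take m = X.restrict m := by
  simp [restrict, ← List.map_take, List.take_range, h]

theorem restrict_prefix (X : Cantor) {m n : ℕ} (h : m ≤ n) : X.restrict m <+: X.restrict n := by
  rw [← X.take_restrict h]
  exact List.take_prefix _ _

theorem mem_cylinders {S : Set (List Bool)} {X : Cantor} :
    X ∈ cylinders S ↔ ∃ n, X.restrict n ∈ S := by
  simp only [cylinders, Set.mem_iUnion, exists_prop]
  constructor
  · rintro ⟨σ, hσ, hX⟩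
    refine ⟨σ.length, ?_⟩
    rwa [show X.restrict σ.length = σ from hX]
  · rintro ⟨n, hn⟩
    exact ⟨_, hn, X.mem_cylinder_restrict n⟩

theorem isClopen_cylinder (σ : List Bool) : IsClopen (cylinder σ) := by
  have : cylinder σ = ⋂ i : Fin σ.length, (fun X : Cantor => X i) ⁻¹' {σ[i]} := by
    ext X
    simp [mem_cylinder_iff, Fin.forall_iff]
  rw [this]
  exact isClopen_iInter_of_finite fun i => (isClopen_discrete _).preimage (continuous_apply _)

theorem isOpen_cylinders (S : Set (List Bool)) : IsOpen (cylinders S) :=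
  isOpen_biUnion fun σ _ => (isClopen_cylinder σ).isOpen

theorem uniform_restrict_mem (F : Finset (List Bool)) {s : ℕ} (hF : ∀ σ ∈ F, σ.length = s) :
    uniform {X | X.restrict s ∈ F} = F.card * (2⁻¹ : ENNReal) ^ s := by
  have : {X : Cantor | X.restrict s ∈ F} = ⋃ σ ∈ F, cylinder σ := by
    ext X
    simp only [Set.mem_ofPred_eq, Set.mem_iUnion, exists_prop]
    constructor
    · intro h
      exact ⟨_, h, X.mem_cylinder_restrict s⟩
    · rintro ⟨σ, hσ, hX⟩
      rw [cylinder, hF σ hσ] at hX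
      rwa [show X.restrict s = σ from hX]
  rw [this, measure_biUnion_finset _ fun σ _ => measurableSet_cylinder σ]
  · rw [Finset.sum_congr rfl fun σ hσ => by rw [uniform_cylinder, hF σ hσ]]
    simp
  · intro σ hσ τ hτ hne
    refine Set.disjoint_left.2 fun X h1 h2 => hne ?_
    simp only [cylinder, Set.mem_ofPred_eq, hF σ hσ, hF τ hτ] at h1 h2
    rw [← h1, h2]

/-! ### Clopen stages of effectively open sets and their dyadic measures -/

/-- The clopen set of sequences having a string that is enumerated by stage `s` among their first
`s + 1` initial segments. -/
def stage (R : List Bool → ℕ → Prop) (s : ℕ) : Set Cantor :=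
  {X | ∃ n < s + 1, R (X.restrict n) s}

theorem monotone_stage {R : List Bool → ℕ → Prop}
    (hR : ∀ σ s t, s ≤ t → R σ s → R σ t) : Monotone (stage R) := by
  rintro s t hst X ⟨n, hn, h⟩
  exact ⟨n, by omega, hR _ _ _ hst h⟩

theorem iUnion_stage {R : List Bool → ℕ → Prop}
    (hR : ∀ σ s t, s ≤ t → R σ s → R σ t) : ⋃ s, stage R s = cylinders {σ | ∃ s, R σ s} := by
  ext X
  simp only [Set.mem_iUnion, mem_cylinders, stage, Set.mem_ofPred_eq]
  constructor
  · rintro ⟨s, n, -, h⟩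
    exact ⟨n, s, h⟩
  · rintro ⟨n, s, h⟩
    exact ⟨max n s, n, by omega, hR _ _ _ (le_max_right _ _) h⟩

open Classical in
/-- The number of strings of length `s` whose cylinder is contained in stage `s`. -/
noncomputable def stageCount (R : List Bool → ℕ → Prop) (s : ℕ) : ℕ :=
  ((binaryStrings s).filter fun ρ => ∃ n < s + 1, R (ρ.take n) s).length

/-- Membership in stage `s` depends only on the first `s` bits, so the measure is a dyadic rational
whose numerator is a finite count. -/
theorem uniform_stage (R : List Bool → ℕ → Prop) (s : ℕ) :
    uniform (stage R s) = stageCount R s * (2⁻¹ : ENNReal) ^ s := by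
  classical
  have hnd := (nodup_binaryStrings s).filter fun ρ => decide (∃ n < s + 1, R (ρ.take n) s)
  have hcard := List.toFinset_card_of_nodup hnd
  have := uniform_restrict_mem
    (((binaryStrings s).filter fun ρ => ∃ n < s + 1, R (ρ.take n) s).toFinset) (s := s)
    (fun σ hσ => by
      rw [List.mem_toFinset, List.mem_filter] at hσ
      exact mem_binaryStrings.1 hσ.1)
  rw [hcard] at this
  unfold stageCount
  convert this using 2
  ext X
  simp only [stage, Set.mem_ofPred_eq, List.mem_toFinset, List.mem_filter, decide_eq_true_eq,
    mem_binaryStrings, length_restrict, true_and]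
  refine exists_congr fun n => and_congr_right fun hn => ?_
  rw [take_restrict X (by omega)]

variable {α : Type*} [Primcodable α]

theorem primrecRel_stage {R : α × List Bool → ℕ → Prop} (hR : PrimrecRel R) :
    PrimrecRel fun (ρ : List Bool) (x : α × ℕ) => ∃ n < x.2 + 1, R (x.1, ρ.take n) x.2 := by
  have h : PrimrecRel fun (n : ℕ) (y : List Bool × α × ℕ) => R (y.2.1, y.1.take n) y.2.2 :=
    hR.comp
      (((Primrec.fst.comp (Primrec.snd.comp Primrec.snd))).pair
        (Primrec.list_take.comp Primrec.fst (Primrec.fst.comp Primrec.snd)))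
      (Primrec.snd.comp (Primrec.snd.comp Primrec.snd))
  have h2 := h.exists_mem_list
  refine PrimrecPred.of_eq (h2.comp (Primrec.list_range.comp
    (Primrec.succ.comp (Primrec.snd.comp Primrec.snd))) Primrec.id) fun x => ?_
  simp

theorem primrec_stageCount {R : α × List Bool → ℕ → Prop} (hR : PrimrecRel R) :
    Primrec fun x : α × ℕ => stageCount (fun ρ => R (x.1, ρ)) x.2 := by
  classical
  exact Primrec.list_length.comp ((primrecRel_stage hR).listFilter.comp
    (primrec_binaryStrings.comp Primrec.snd) Primrec.id)

/-- Both measures are increasing limits of computable dyadics, so the strict inequality, if true, is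
already visible at a finite stage. The second summand serves to move a measure to the other side via
its complement. -/
theorem rePred_one_lt_uniform {p q : α × List Bool → Prop} (hp : REPred p) (hq : REPred q)
    (k : ℕ) : REPred fun a => 1 < 2 ^ k * uniform (cylinders {σ | p (a, σ)}) +
      uniform (cylinders {σ | q (a, σ)}) := by
  obtain ⟨R, hR, hRm, hRp⟩ := hp.exists_stages
  obtain ⟨Q, hQ, hQm, hQq⟩ := hq.exists_stages
  have h : PrimrecRel fun (a : α) (s : ℕ) => 2 ^ s <
      2 ^ k * stageCount (fun ρ => R (a, ρ)) s + stageCount (fun ρ => Q (a, ρ)) s := by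
    have hpow : Primrec fun s : ℕ => 2 ^ s :=
      (Primrec.nat_rec₁ 1 (f := fun _ m => 2 * m)
        (Primrec.nat_mul.comp (Primrec.const 2) Primrec.snd)).of_eq fun s => by
          induction s with
          | zero => rfl
          | succ s ih => rw [pow_succ', ← ih]
    exact Primrec.nat_lt.comp (hpow.comp Primrec.snd)
      (Primrec.nat_add.comp (Primrec.nat_mul.comp (Primrec.const _) (primrec_stageCount hR))
        (primrec_stageCount hQ))
  refine h.rePred_exists.of_eq fun a => ?_
  have hstage : ∀ s, 2 ^ s < 2 ^ k * stageCount (fun ρ => R (a, ρ)) s +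
      stageCount (fun ρ => Q (a, ρ)) s ↔ 1 < 2 ^ k * uniform (stage (fun ρ => R (a, ρ)) s) +
        uniform (stage (fun ρ => Q (a, ρ)) s) := by
    intro s
    rw [uniform_stage, uniform_stage, ← mul_assoc, ← add_mul, ← ENNReal.inv_pow,
      ← div_eq_mul_inv, ENNReal.lt_div_iff_mul_lt (by simp) (by simp), one_mul]
    exact_mod_cast Iff.rfl
  have hmR := monotone_stage (R := fun ρ => R (a, ρ)) fun σ => hRm (a, σ)
  have hmQ := monotone_stage (R := fun ρ => Q (a, ρ)) fun σ => hQm (a, σ)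
  have hR1 := iUnion_stage (R := fun ρ => R (a, ρ)) fun σ => hRm (a, σ)
  have hQ1 := iUnion_stage (R := fun ρ => Q (a, ρ)) fun σ => hQm (a, σ)
  simp only [hstage, hRp, hQq, ← hR1, ← hQ1]
  constructor
  · rintro ⟨s, hs⟩
    refine hs.trans_le (add_le_add (mul_le_mul_right ?_ _) ?_)
    · exact measure_mono (Set.subset_iUnion _ s)
    · exact measure_mono (Set.subset_iUnion _ s)
  · intro hlt
    have ht := (ENNReal.Tendsto.const_mul (a := (2 : ENNReal) ^ k)
      (tendsto_measure_iUnion_atTop (μ := uniform) hmR) (Or.inr (by simp))).add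
      (tendsto_measure_iUnion_atTop (μ := uniform) hmQ)
    exact (ht.eventually_const_lt hlt).exists

end Cantor

/-! ### A maximal inequality and basic properties of weak 2-randomness -/

namespace Cantor

/-- The maximal inequality for the ratio of two measures along initial segments. -/
theorem measure_cylinders_le {μ ν : Measure Cantor} {c : ENNReal} {T : Set (List Bool)}
    (hT : ∀ τ ∈ T, μ (cylinder τ) ≤ c * ν (cylinder τ)) :
    μ (cylinders T) ≤ c * ν Set.univ := by
  -- The prefix-minimal strings of `T` generate the same open set with disjoint cylinders, so the
  -- hypothesis can be summed.
  let M : Set (List Bool) := {τ | τ ∈ T ∧ ∀ τ₁ ∈ T, τ₁ <+: τ → τ₁ = τ}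
  have hM : cylinders T = ⋃ τ ∈ M, cylinder τ := by
    classical
    ext X
    constructor
    · intro hX
      have hX := mem_cylinders.1 hX
      refine Set.mem_biUnion (x := X.restrict (Nat.find hX)) ⟨Nat.find_spec hX, ?_⟩
        (X.mem_cylinder_restrict _)
      intro τ hτ hp
      have hXτ : X.restrict τ.length = τ :=
        TuringFunctional.cylinder_anti hp (X.mem_cylinder_restrict _)
      refine hp.eq_of_length_le ?_
      rw [length_restrict]
      exact Nat.find_min' hX (hXτ.symm ▸ hτ)
    · intro hX
      obtain ⟨τ, hτ, h⟩ := Set.mem_iUnion₂.1 hX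
      exact Set.mem_biUnion hτ.1 h
  have hd : M.PairwiseDisjoint cylinder := by
    intro σ hσ τ hτ hne
    refine Set.disjoint_left.2 fun X h1 h2 => hne ?_
    rcases le_total σ.length τ.length with hl | hl
    · exact hτ.2 _ hσ.1 (TuringFunctional.cylinder_comparable h1 h2 hl)
    · exact (hσ.2 _ hτ.1 (TuringFunctional.cylinder_comparable h2 h1 hl)).symm
  calc μ (cylinders T) = ∑' τ : M, μ (cylinder τ) := by
        rw [hM, measure_biUnion M.to_countable hd fun τ _ => measurableSet_cylinder τ]
    _ ≤ ∑' τ : M, c * ν (cylinder τ) := ENNReal.tsum_le_tsum fun τ => hT _ τ.2.1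
    _ = c * ν (cylinders T) := by
        rw [ENNReal.tsum_mul_left, hM,
          measure_biUnion M.to_countable hd fun τ _ => measurableSet_cylinder τ]
    _ ≤ c * ν Set.univ := mul_le_mul_right (measure_mono (Set.subset_univ _)) _

theorem measure_cylinder_restrict_ne_zero {μ : Measure Cantor} {Y : Cantor}
    (hY : WeaklyTwoRandom μ Y) (n : ℕ) : μ (cylinder (Y.restrict n)) ≠ 0 := by
  intro h0
  refine hY (fun _ => cylinder (Y.restrict n)) ⟨⟨fun _ => {Y.restrict n}, ?_, fun i => ?_⟩, ?_⟩
    (Set.mem_iInter.2 fun _ => Y.mem_cylinder_restrict n)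
  · exact PrimrecPred.rePred (Primrec.eq.comp Primrec.snd (Primrec.const _))
  · simp [cylinders]
  · simp [h0]

/-- A weakly 2-random sequence meets every effectively open set of full measure. -/
theorem WeaklyTwoRandom.mem_cylinders {μ : Measure Cantor} [IsProbabilityMeasure μ] {X : Cantor}
    (hX : WeaklyTwoRandom μ X) {p : List Bool → Prop} (hp : REPred p)
    (h1 : μ (cylinders {σ | p σ})ᶜ = 0) : X ∈ cylinders {σ | p σ} := by
  obtain ⟨R, hR, hRm, hRp⟩ := hp.exists_stages
  simp only [hRp] at h1 ⊢
  rw [← iUnion_stage hRm] at h1 ⊢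
  by_contra hXn
  -- The complements of the stages are clopen, uniformly decidable, and decrease to a null set: they
  -- form a generalized test.
  have hmem : ∀ s, (stage R s)ᶜ =
      cylinders {ρ | ρ.length = s ∧ ¬ ∃ n < s + 1, R (ρ.take n) s} := by
    intro s
    ext Z
    have hiff : (∃ n < s + 1, R ((Z.restrict s).take n) s) ↔ Z ∈ stage R s :=
      exists_congr fun n => and_congr_right fun hn => by rw [take_restrict Z (by omega)]
    rw [Cantor.mem_cylinders, Set.mem_compl_iff, ← hiff]
    constructor
    · exact fun h => ⟨s, length_restrict Z s, h⟩
    · rintro ⟨m, hm, h⟩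
      rw [length_restrict] at hm
      exact hm ▸ h
  refine hX (fun s => (stage R s)ᶜ) ⟨⟨_, ?_, hmem⟩, ?_⟩ ?_
  · have hR' : PrimrecRel fun (x : Unit × List Bool) (s : ℕ) => R x.2 s :=
      hR.comp (Primrec.snd.comp Primrec.fst) Primrec.snd
    refine PrimrecPred.rePred (PrimrecPred.and
      (Primrec.eq.comp (Primrec.list_length.comp Primrec.snd) Primrec.fst) ?_)
    exact ((primrecRel_stage hR').comp Primrec.snd
      ((Primrec.const ()).pair Primrec.fst)).not
  · have hanti : Antitone fun s => (stage R s)ᶜ :=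
      fun s t hst => Set.compl_subset_compl.2 (monotone_stage hRm hst)
    have ht := tendsto_measure_iInter_atTop (μ := μ) (s := fun s => (stage R s)ᶜ)
      (fun s => by
        rw [hmem]
        exact (measurableSet_cylinders _).nullMeasurableSet) hanti ⟨0, measure_ne_top _ _⟩
    rwa [← Set.compl_iUnion, h1] at ht
  · rw [← Set.compl_iUnion]
    exact hXn

end Cantor

/-! ### Effective estimates for the conditional measures -/

namespace TuringFunctional

open Cantor

variable {Φ : TuringFunctional}

theorem AlmostTotal.ae_mem_dom (hΦ : Φ.AlmostTotal) : ∀ᵐ X ∂uniform, X ∈ Φ.dom :=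
  (mem_ae_iff_prob_eq_one Φ.measurableSet_dom).2 hΦ

theorem rePred_output {α : Type*} [Primcodable α] {r : (List Bool × α) × List Bool → Prop}
    (hr : REPred r) :
    REPred fun x : α × List Bool => ∃ τ, (x.2, τ) ∈ Φ.pairs ∧ r ((τ, x.1), x.2) := by
  have h1 : REPred fun y : (α × List Bool) × List Bool => (y.1.2, y.2) ∈ Φ.pairs :=
    Φ.ce.comp ((Primrec.snd.comp Primrec.fst).pair Primrec.snd).to_comp
  have h2 : REPred fun y : (α × List Bool) × List Bool => r ((y.2, y.1.1), y.1.2) :=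
    hr.comp ((Primrec.snd.pair (Primrec.fst.comp Primrec.fst)).pair
      (Primrec.snd.comp Primrec.fst)).to_comp
  exact (h1.and h2).exists

/-- The domain is the intersection over `n` of the effectively open sets where some output has
length at least `n`; each has full measure. -/
theorem mem_dom_of_weaklyTwoRandom (hΦ : Φ.AlmostTotal) {X : Cantor}
    (hX : WeaklyTwoRandom uniform X) : X ∈ Φ.dom := by
  rw [mem_dom_iff]
  intro n
  have hp : REPred fun σ : List Bool => ∃ τ, (σ, τ) ∈ Φ.pairs ∧ n ≤ τ.length := by
    have h2 : REPred fun y : List Bool × List Bool => n ≤ y.2.length :=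
      PrimrecPred.rePred (Primrec.nat_le.comp (Primrec.const n)
        (Primrec.list_length.comp Primrec.snd))
    exact (Φ.ce.and h2).exists
  have hiff : ∀ Z, Z ∈ cylinders {σ | ∃ τ, (σ, τ) ∈ Φ.pairs ∧ n ≤ τ.length} ↔
      ∃ τ ∈ Φ.outputs Z, n ≤ τ.length := by
    intro Z
    simp only [cylinders, outputs, Set.mem_iUnion, Set.mem_ofPred_eq, exists_prop]
    constructor
    · rintro ⟨σ, ⟨τ, h, hn⟩, hZ⟩
      exact ⟨τ, ⟨σ, h, hZ⟩, hn⟩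
    · rintro ⟨τ, ⟨σ, h, hZ⟩, hn⟩
      exact ⟨σ, ⟨τ, h, hn⟩, hZ⟩
  refine (hiff X).1 (hX.mem_cylinders hp ?_)
  refine measure_mono_null (Set.compl_subset_compl.2 fun Z hZ => ?_)
    ((prob_compl_eq_zero_iff Φ.measurableSet_dom).2 hΦ)
  exact (hiff Z).2 (mem_dom_iff.1 hZ n)

/-- The strings that force `Φ^X` to be incompatible with `τ`, once it is long enough. -/
def avoiding (Φ : TuringFunctional) (τ : List Bool) : Set (List Bool) :=
  {σ | ∃ τ₁, (σ, τ₁) ∈ Φ.pairs ∧ τ.length ≤ τ₁.length ∧ ¬ τ <+: τ₁}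

theorem mem_cylinders_avoiding {X : Cantor} (hX : X ∈ Φ.dom) (τ : List Bool) :
    X ∈ cylinders (Φ.avoiding τ) ↔ Φ.apply X ∉ cylinder τ := by
  have hm := maps_apply hX
  simp only [cylinders, avoiding, Set.mem_iUnion, Set.mem_ofPred_eq, exists_prop]
  constructor
  · rintro ⟨σ, ⟨τ₁, hσ, hl, hn⟩, hXσ⟩ h
    exact hn (cylinder_comparable h (hm.1 _ ⟨σ, hσ, hXσ⟩) hl)
  · intro h
    obtain ⟨τ₁, ⟨σ, hσ, hXσ⟩, hl⟩ := hm.2 τ.length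
    exact ⟨σ, ⟨τ₁, hσ, hl, fun hp => h (cylinder_anti hp (hm.1 _ ⟨σ, hσ, hXσ⟩))⟩, hXσ⟩

/-- Up to a null set, avoidance is the complement of the preimage. As its measure is approximable
from below, `λ_Φ⟦τ⟧` is approximable from above. -/
theorem inducedMeasure_add_avoiding (hΦ : Φ.AlmostTotal) (τ : List Bool) :
    Φ.inducedMeasure (cylinder τ) + uniform (cylinders (Φ.avoiding τ)) = 1 := by
  have h : uniform (cylinders (Φ.avoiding τ)) = uniform (Φ.apply ⁻¹' cylinder τ)ᶜ := by
    refine measure_congr ?_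
    filter_upwards [hΦ.ae_mem_dom] with X hX
    exact propext (mem_cylinders_avoiding hX τ)
  rw [h, inducedMeasure, Measure.map_apply Φ.measurable_apply (measurableSet_cylinder τ),
    measure_add_measure_compl (Φ.measurable_apply (measurableSet_cylinder τ)), measure_univ]

/-- Adding the measure of the avoiding set to both sides turns the left side into 1, and leaves only
quantities approximable from below. -/
theorem rePred_inducedMeasure_lt (hΦ : Φ.AlmostTotal) {S : ℕ → Set (List Bool)}
    (hS : UniformlyCE S) (k : ℕ) :
    REPred fun x : ℕ × List Bool => Φ.inducedMeasure (cylinder x.2) <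
      2 ^ k * uniform (cylinders (S x.1) ∩ Φ.apply ⁻¹' cylinder x.2) := by
  -- Closing sets of strings under extension lets an intersection of two open sets be generated by
  -- the intersection of their sets of strings.
  have hext : ∀ {α : Type} [Primcodable α] {r : α × List Bool → Prop}, REPred r →
      REPred fun x : α × List Bool => ∃ σ, r (x.1, σ) ∧ σ <+: x.2 := by
    intro α _ r hr
    have h1 : REPred fun y : (α × List Bool) × List Bool => r (y.1.1, y.2) :=
      hr.comp ((Primrec.fst.comp Primrec.fst).pair Primrec.snd).to_comp
    have h2 : REPred fun y : (α × List Bool) × List Bool => y.2 <+: y.1.2 :=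
      PrimrecPred.rePred
        (primrecRel_prefix.comp Primrec.snd (Primrec.snd.comp Primrec.fst))
    exact (h1.and h2).exists
  have hpre : REPred fun x : List Bool × List Bool => ∃ τ, (x.2, τ) ∈ Φ.pairs ∧ x.1 <+: τ :=
    rePred_output (r := fun y : (List Bool × List Bool) × List Bool => y.1.2 <+: y.1.1)
      (PrimrecPred.rePred (primrecRel_prefix.comp (Primrec.snd.comp Primrec.fst)
        (Primrec.fst.comp Primrec.fst)))
  have hp : REPred fun y : (ℕ × List Bool) × List Bool =>
      (∃ σ, σ ∈ S y.1.1 ∧ σ <+: y.2) ∧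
        ∃ σ, (∃ τ, (σ, τ) ∈ Φ.pairs ∧ y.1.2 <+: τ) ∧ σ <+: y.2 :=
    ((hext hS).comp
      ((Primrec.fst.comp Primrec.fst).pair Primrec.snd).to_comp).and
    ((hext hpre).comp
      ((Primrec.snd.comp Primrec.fst).pair Primrec.snd).to_comp)
  have hq : REPred fun y : (ℕ × List Bool) × List Bool => y.2 ∈ Φ.avoiding y.1.2 :=
    rePred_output (r := fun y : (List Bool × ℕ × List Bool) × List Bool =>
        y.1.2.2.length ≤ y.1.1.length ∧ ¬ y.1.2.2 <+: y.1.1)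
      (PrimrecPred.rePred (PrimrecPred.and
        (Primrec.nat_le.comp
          (Primrec.list_length.comp (Primrec.snd.comp (Primrec.snd.comp Primrec.fst)))
          (Primrec.list_length.comp (Primrec.fst.comp Primrec.fst)))
        (primrecRel_prefix.comp (Primrec.snd.comp (Primrec.snd.comp Primrec.fst))
          (Primrec.fst.comp Primrec.fst)).not))
  refine (rePred_one_lt_uniform hp hq k).of_eq fun x => ?_
  have hA : uniform (cylinders {ρ | (∃ σ, σ ∈ S x.1 ∧ σ <+: ρ) ∧
      ∃ σ, (∃ τ, (σ, τ) ∈ Φ.pairs ∧ x.2 <+: τ) ∧ σ <+: ρ}) =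
      uniform (cylinders (S x.1) ∩ Φ.apply ⁻¹' cylinder x.2) := by
    refine measure_congr ?_
    filter_upwards [hΦ.ae_mem_dom] with X hX
    refine propext ?_
    change X ∈ cylinders _ ↔ X ∈ cylinders (S x.1) ∧ Φ.apply X ∈ cylinder x.2
    rw [apply_mem_cylinder hX, mem_cylinders, mem_cylinders, mem_cylinders]
    constructor
    · rintro ⟨n, ⟨σ, hσ, hp⟩, ρ, ⟨τ, hρ, hτ⟩, hp'⟩
      have h1 : X.restrict σ.length = σ := cylinder_anti hp (X.mem_cylinder_restrict n)
      have h2 : X.restrict ρ.length = ρ := cylinder_anti hp' (X.mem_cylinder_restrict n)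
      exact ⟨⟨σ.length, h1.symm ▸ hσ⟩, ρ.length, h2.symm ▸ ⟨τ, hτ, hρ⟩⟩
    · rintro ⟨⟨m, hm⟩, n, τ, hτ, hn⟩
      exact ⟨max m n, ⟨_, hm, X.restrict_prefix (le_max_left _ _)⟩,
        _, ⟨τ, hn, hτ⟩, X.restrict_prefix (le_max_right _ _)⟩
  change 1 < _ + uniform (cylinders (Φ.avoiding x.2)) ↔ _
  rw [hA, ← inducedMeasure_add_avoiding hΦ x.2]
  exact ENNReal.add_lt_add_iff_right (measure_ne_top _ _)

/-- Along a `λ_Φ`-weakly 2-random sequence, the conditional measures of some component of a test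
for the uniform measure are small. -/
theorem exists_conditional_le (hΦ : Φ.AlmostTotal) {Y : Cantor}
    (hY : WeaklyTwoRandom Φ.inducedMeasure Y) {U : ℕ → Set Cantor}
    (hU : IsGeneralizedMLTest uniform U) (k : ℕ) :
    ∃ i, ∀ m, 2 ^ k * uniform (U i ∩ Φ.apply ⁻¹' cylinder (Y.restrict m)) ≤
      Φ.inducedMeasure (cylinder (Y.restrict m)) := by
  obtain ⟨S, hS, hUS⟩ := hU.effectivelyOpen
  let T : ℕ → Set (List Bool) := fun i => {τ | Φ.inducedMeasure (cylinder τ) <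
    2 ^ k * uniform (cylinders (S i) ∩ Φ.apply ⁻¹' cylinder τ)}
  have hT : IsGeneralizedMLTest Φ.inducedMeasure fun i => cylinders (T i) := by
    refine ⟨⟨T, rePred_inducedMeasure_lt hΦ hS k, fun _ => rfl⟩, ?_⟩
    have hlim : Tendsto (fun i => 2 ^ k * uniform (U i)) atTop (𝓝 0) := by
      simpa using ENNReal.Tendsto.const_mul (a := (2 : ENNReal) ^ k) hU.tendsto_zero
        (Or.inr (by simp))
    refine tendsto_of_tendsto_of_tendsto_of_le_of_le tendsto_const_nhds hlim
      (fun _ => zero_le) fun i => ?_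
    -- The comparison measure is the image under `Φ` of `λ` restricted to `U i`; its total mass is
    -- `λ(U i)`.
    have hν : ∀ A, MeasurableSet A → ((uniform.restrict (U i)).map Φ.apply) A =
        uniform (U i ∩ Φ.apply ⁻¹' A) := fun A hA => by
      rw [Measure.map_apply Φ.measurable_apply hA,
        Measure.restrict_apply (Φ.measurable_apply hA), Set.inter_comm]
    refine (measure_cylinders_le (ν := (uniform.restrict (U i)).map Φ.apply)
      (c := 2 ^ k) fun τ hτ => ?_).trans_eq ?_
    · rw [hν _ (measurableSet_cylinder τ), hUS]
      exact (show _ < _ from hτ).le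
    · rw [hν _ MeasurableSet.univ, Set.preimage_univ, Set.inter_univ]
  have hYT := hY _ hT
  simp only [Set.mem_iInter, not_forall, mem_cylinders, not_exists] at hYT
  obtain ⟨i, hi⟩ := hYT
  refine ⟨i, fun m => ?_⟩
  rw [hUS]
  exact not_lt.1 (hi m)

/-! ### Closed substitutes for preimages of cylinders -/

/-- The sequences `X` all of whose outputs are compatible with `τ`. -/
def compatible (Φ : TuringFunctional) (τ : List Bool) : Set Cantor :=
  {X | ∀ τ₁ ∈ Φ.outputs X, τ₁ <+: τ ∨ τ <+: τ₁}

/-- An incompatible output appears after finitely many bits. Preimages of cylinders need not be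
closed, as the domain need not be; these sets agree with them on the domain and supply the
compactness. -/
theorem isClosed_compatible (τ : List Bool) : IsClosed (Φ.compatible τ) := by
  have : Φ.compatible τ =
      (cylinders {σ | ∃ τ₁, (σ, τ₁) ∈ Φ.pairs ∧ ¬ (τ₁ <+: τ ∨ τ <+: τ₁)})ᶜ := by
    ext X
    simp only [compatible, outputs, cylinders, Set.mem_ofPred_eq, Set.mem_compl_iff,
      Set.mem_iUnion, exists_prop]
    constructor
    · rintro h ⟨σ, ⟨τ₁, hσ, hn⟩, hX⟩
      exact hn (h τ₁ ⟨σ, hσ, hX⟩)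
    · rintro h τ₁ ⟨σ, hσ, hX⟩
      by_contra hn
      exact h ⟨σ, ⟨τ₁, hσ, hn⟩, hX⟩
  rw [this]
  exact (isOpen_cylinders _).isClosed_compl

theorem compatible_anti {σ τ : List Bool} (h : σ <+: τ) : Φ.compatible τ ⊆ Φ.compatible σ := by
  intro X hX τ₁ hτ₁
  rcases hX τ₁ hτ₁ with h1 | h1
  · exact List.prefix_or_prefix_of_prefix h1 h
  · exact Or.inr (h.trans h1)

theorem mem_compatible_of_apply_mem {X : Cantor} (hX : X ∈ Φ.dom) {τ : List Bool}
    (h : Φ.apply X ∈ cylinder τ) : X ∈ Φ.compatible τ := by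
  intro τ₁ hτ₁
  have h1 := (maps_apply hX).1 τ₁ hτ₁
  rcases le_total τ₁.length τ.length with hl | hl
  · exact Or.inl (cylinder_comparable h1 h hl)
  · exact Or.inr (cylinder_comparable h h1 hl)

theorem apply_mem_of_mem_compatible {X : Cantor} (hX : X ∈ Φ.dom) {τ : List Bool}
    (h : X ∈ Φ.compatible τ) : Φ.apply X ∈ cylinder τ := by
  obtain ⟨τ₁, hτ₁, hl⟩ := (maps_apply hX).2 τ.length
  have h1 := (maps_apply hX).1 τ₁ hτ₁
  rcases h τ₁ hτ₁ with hp | hp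
  · rwa [← hp.eq_of_length_le hl]
  · exact cylinder_anti hp h1

end TuringFunctional

/-! ### Union over all tests and compactness -/

theorem mainTheorem6 (Φ : TuringFunctional) (hΦ : Φ.AlmostTotal) (Y : Cantor)
    (hY : Cantor.WeaklyTwoRandom Φ.inducedMeasure Y) :
    ∃ X : Cantor, Cantor.WeaklyTwoRandom Cantor.uniform X ∧ X ∈ Φ.dom ∧ Φ.apply X = Y := by
  open Cantor TuringFunctional in
  let 𝒯 := {U : ℕ → Set Cantor | IsGeneralizedMLTest uniform U}
  have : Countable 𝒯 := (countable_isGeneralizedMLTest uniform).to_subtype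
  obtain ⟨ε, hε, hsum⟩ := ENNReal.exists_pos_sum_of_countable' one_ne_zero 𝒯
  have hk : ∀ U : 𝒯, ∃ k : ℕ, (2⁻¹ : ENNReal) ^ k < ε U := fun U =>
    ENNReal.exists_inv_two_pow_lt (hε U).ne'
  choose k hk using hk
  choose i hi using fun U : 𝒯 => exists_conditional_le hΦ hY U.2 (k U)
  let O : Set Cantor := ⋃ U : 𝒯, U.1 (i U)
  have hO : IsOpen O := by
    refine isOpen_iUnion fun U => ?_
    obtain ⟨S, -, hUS⟩ := U.2.effectivelyOpen
    rw [hUS]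
    exact isOpen_cylinders _
  have hpos : ∀ m, Φ.inducedMeasure (cylinder (Y.restrict m)) ≠ 0 :=
    measure_cylinder_restrict_ne_zero hY
  have hmap : ∀ m, Φ.inducedMeasure (cylinder (Y.restrict m)) =
      uniform (Φ.apply ⁻¹' cylinder (Y.restrict m)) := fun m =>
    Measure.map_apply Φ.measurable_apply (measurableSet_cylinder _)
  have hlt : ∀ m, uniform (O ∩ Φ.apply ⁻¹' cylinder (Y.restrict m)) <
      uniform (Φ.apply ⁻¹' cylinder (Y.restrict m)) := by
    intro m
    rw [← hmap]
    have hle : ∀ U : 𝒯, uniform (U.1 (i U) ∩ Φ.apply ⁻¹' cylinder (Y.restrict m)) ≤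
        ε U * Φ.inducedMeasure (cylinder (Y.restrict m)) := by
      intro U
      calc _ = (2⁻¹ : ENNReal) ^ k U *
            (2 ^ k U * uniform (U.1 (i U) ∩ Φ.apply ⁻¹' cylinder (Y.restrict m))) := by
            rw [← mul_assoc, ← mul_pow, ENNReal.inv_mul_cancel (by simp) (by simp), one_pow,
              one_mul]
        _ ≤ _ := mul_le_mul' (hk U).le (hi U m)
    calc _ ≤ ∑' U : 𝒯, uniform (U.1 (i U) ∩ Φ.apply ⁻¹' cylinder (Y.restrict m)) := by
          rw [Set.iUnion_inter]
          exact measure_iUnion_le _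
      _ ≤ ∑' U : 𝒯, ε U * Φ.inducedMeasure (cylinder (Y.restrict m)) :=
          ENNReal.tsum_le_tsum hle
      _ = (∑' U : 𝒯, ε U) * Φ.inducedMeasure (cylinder (Y.restrict m)) := ENNReal.tsum_mul_right
      _ < 1 * Φ.inducedMeasure (cylinder (Y.restrict m)) := by
          -- Strictness needs the cylinders around `Y` to have positive measure: a null one would
          -- itself be a constant test capturing `Y`.
          refine ENNReal.mul_lt_mul_left (hpos m) ?_ hsum
          rw [hmap]
          exact measure_ne_top _ _
      _ = _ := one_mul _
  have hne : ∀ m, (Oᶜ ∩ Φ.compatible (Y.restrict m)).Nonempty := by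
    intro m
    by_contra hempty
    -- Were the intersection empty, `O` would contain almost all of the preimage of the cylinder.
    refine (hlt m).not_ge (measure_mono_ae ?_)
    filter_upwards [hΦ.ae_mem_dom] with X hX h
    refine ⟨?_, h⟩
    by_contra hXO
    exact hempty ⟨X, hXO, mem_compatible_of_apply_mem hX h⟩
  have hclosed : ∀ m, IsClosed (Oᶜ ∩ Φ.compatible (Y.restrict m)) := fun m =>
    hO.isClosed_compl.inter (isClosed_compatible _)
  obtain ⟨X, hX⟩ := IsCompact.nonempty_iInter_of_sequence_nonempty_isCompact_isClosed
    (fun m => Oᶜ ∩ Φ.compatible (Y.restrict m))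
    (fun m => Set.inter_subset_inter_right _ (compatible_anti (Y.restrict_prefix m.le_succ)))
    hne (hclosed 0).isCompact hclosed
  rw [Set.mem_iInter] at hX
  -- Every test has its chosen component inside `O`, which `X` avoids.
  have hXr : WeaklyTwoRandom uniform X := fun U hU h =>
    (hX 0).1 (Set.mem_iUnion.2 ⟨⟨U, hU⟩, Set.mem_iInter.1 h _⟩)
  have hXd := mem_dom_of_weaklyTwoRandom hΦ hXr
  refine ⟨X, hXr, hXd, ?_⟩
  funext n
  have h := apply_mem_of_mem_compatible hXd (hX (n + 1)).2
  have hn : n < (Y.restrict (n + 1)).length := by simp [length_restrict]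
  rw [mem_cylinder_iff.1 h n hn, mem_cylinder_iff.1 (Y.mem_cylinder_restrict (n + 1)) n hn]
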